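/- Let $U(2)$ be the group of $2\times 2$ complex unitary matrices, and let $dX$ be Haar measure on it, normalized to be a probability measure. For $X\in U(2)$ and $s\in\mathbb{C}$ let $\Lambda_X(s)=\det(I-sX^{\dagger})$, where $X^{\dagger}$ is the conjugate transpose of $X$, and let $\Lambda_X'$ be its derivative in $s$. Then for every positive integer $k$ and every complex number $x$, $$\int_{U(2)}|\Lambda_X'(x)|^{2k}\,dX=\sum_{m=0}^{k}\frac{\binom{k}{m}^2\,(4|x|^2)^m\,\binom{2k-2m}{k-m}}{k-m+1}=\frac{\binom{2k}{k}}{k+1}\;{}_3F_2\!\left(-1-k,-k,-k;\,1,\tfrac12-k;\,|x|^2\right),$$ where $${}_3F_2(a_1,a_2,a_3;b_1,b_2;z)=\sum_{n=0}^{\infty}\frac{(a_1)_n(a_2)_n(a_3)_n}{(b_1)_n(b_2)_n}\,\frac{z^n}{n!},\qquad (a)_0=1,\quad (a)_n=a(a+1)\cdots(a+n-1)\ \ (n\ge 1).$$ -/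

import Mathlib

open MeasureTheory

/-- The unitary group `U(N)` carries the Borel σ-algebra of its (entrywise) topology. -/
noncomputable instance unitaryGroupMeasurableSpace (N : ℕ) :
    MeasurableSpace (Matrix.unitaryGroup (Fin N) ℂ) := borel _

instance unitaryGroupBorelSpace (N : ℕ) :
    BorelSpace (Matrix.unitaryGroup (Fin N) ℂ) := ⟨rfl⟩

theorem isCompact_unitaryGroup (N : ℕ) :
    IsCompact (Matrix.unitaryGroup (Fin N) ℂ : Set (Matrix (Fin N) (Fin N) ℂ)) := by
  have hK : IsCompact (Set.univ.pi fun _ : Fin N => Set.univ.pi fun _ : Fin N =>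
      Metric.closedBall (0 : ℂ) 1) :=
    isCompact_univ_pi fun _ => isCompact_univ_pi fun _ => isCompact_closedBall _ _
  refine IsCompact.of_isClosed_subset hK ?_ ?_
  · have : (Matrix.unitaryGroup (Fin N) ℂ : Set (Matrix (Fin N) (Fin N) ℂ)) =
        {A | A * star A = 1} := by
      ext A
      exact Matrix.mem_unitaryGroup_iff
    rw [this]
    exact isClosed_eq (continuous_id.mul continuous_star) continuous_const
  · intro A hA i _ j _
    simpa using entry_norm_bound_of_unitary hA i j

instance unitaryGroupCompactSpace (N : ℕ) :
    CompactSpace (Matrix.unitaryGroup (Fin N) ℂ) :=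
  isCompact_iff_compactSpace.mp (isCompact_unitaryGroup N)

/-- Haar measure `dX` on `U(N)`, normalized so that the whole group has measure `1`. -/
noncomputable def haarU (N : ℕ) : Measure (Matrix.unitaryGroup (Fin N) ℂ) :=
  Measure.haarMeasure ⊤

/-- The characteristic polynomial `Λ_X(s) = det (I - s X†)` of `X ∈ U(N)`, as a function of the
complex variable `s`; here `X†` is the conjugate transpose of `X`. -/
noncomputable def charPolyU {N : ℕ} (X : Matrix.unitaryGroup (Fin N) ℂ) (s : ℂ) : ℂ :=
  Matrix.det (1 - s • Matrix.conjTranspose (X : Matrix (Fin N) (Fin N) ℂ))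

/-- The rising factorial (Pochhammer symbol) `(a)_n = a (a + 1) ⋯ (a + n - 1)`, `(a)_0 = 1`. -/
noncomputable def risingFactorial (a : ℂ) (n : ℕ) : ℂ :=
  ∏ i ∈ Finset.range n, (a + i)

/-- The hypergeometric series
`₃F₂(a₁, a₂, a₃; b₁, b₂; z) = ∑ (a₁)_n (a₂)_n (a₃)_n / ((b₁)_n (b₂)_n) * z ^ n / n!`.
It is meaningful when neither `b₁` nor `b₂` is a non-positive integer and the series converges
(for instance when some `aᵢ` is a non-positive integer, so that it has finitely many non-zero
terms). -/
noncomputable def hypergeometric₃F₂ (a₁ a₂ a₃ b₁ b₂ z : ℂ) : ℂ :=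
  ∑' n : ℕ, risingFactorial a₁ n * risingFactorial a₂ n * risingFactorial a₃ n /
    (risingFactorial b₁ n * risingFactorial b₂ n) * (z ^ n / (n.factorial : ℂ))

/-! For `2 × 2` matrices `Λ_X'(x)` is, up to conjugation and sign, `-2 x̄ det X + tr X`. Left
translation by the scalar `exp I` multiplies `det` by `exp (2I)` and `tr` by `exp I`. Since `exp I`
is not a root of unity, Haar invariance kills all cross terms in the `2k`-th moment
(`integral_norm_add_pow`), which leaves the moments of `|tr X|`. Rephasing row 0 splits `tr X = X₀₀
+ X₁₁` in the same way, and `|X₁₁| = |X₀₀|` reduces everything to `E|X₀₀|^(2j) = 1/(j+1)`, a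
consequence of rotation invariance. The `₃F₂` form follows by comparing ratios of consecutive terms.
-/

open Complex in
theorem exp_I_zpow_ne_one {n : ℤ} (hn : n ≠ 0) : (exp I) ^ n ≠ 1 := by
  rw [← exp_int_mul, Ne, exp_eq_one_iff]
  rintro ⟨m, hm⟩
  have h : (n : ℂ) = m * (2 * Real.pi) := by
    have := mul_right_cancel₀ I_ne_zero (hm.trans (by ring : _ = (m * (2 * Real.pi)) * I))
    exact this
  have hR : (n : ℝ) = m * (2 * Real.pi) := by exact_mod_cast h
  have hm0 : (m : ℝ) ≠ 0 := by
    rintro h0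
    rw [h0, zero_mul] at hR
    exact hn (by exact_mod_cast hR)
  -- Otherwise `π = n / (2m)` would be rational.
  refine irrational_pi ⟨(n : ℚ) / (2 * m), ?_⟩
  push_cast
  rw [hR]
  field_simp

theorem norm_exp_I : ‖Complex.exp Complex.I‖ = 1 := by
  simpa using Complex.norm_exp_ofReal_mul_I 1

theorem mul_star_self_of_norm_eq_one {z : ℂ} (h : ‖z‖ = 1) : z * star z = 1 := by
  have h' := Complex.mul_conj' z
  rw [h] at h'
  simpa using h'

/-- Expansion of `|u + v|²ᵏ` into monomials in `u`, `v` and their conjugates. -/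
theorem norm_add_pow_two_mul (u v : ℂ) (k : ℕ) :
    ((‖u + v‖ ^ (2 * k) : ℝ) : ℂ) = ∑ i ∈ Finset.range (k + 1), ∑ j ∈ Finset.range (k + 1),
      ((k.choose i : ℂ) * (k.choose j : ℂ)) *
        (u ^ i * v ^ (k - i) * star (u ^ j * v ^ (k - j))) := by
  have h : ((‖u + v‖ ^ (2 * k) : ℝ) : ℂ) = (u + v) ^ k * star ((u + v) ^ k) := by
    rw [pow_mul]
    push_cast
    rw [← Complex.mul_conj', mul_pow, star_pow]
    rfl
  rw [h, add_pow, star_sum, Finset.sum_mul_sum]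
  refine Finset.sum_congr rfl fun i _ => Finset.sum_congr rfl fun j _ => ?_
  simp only [star_mul', star_natCast]
  ring

/-! ### Vanishing of cross terms by phase invariance -/

section PhaseAveraging

variable {G : Type*} [TopologicalSpace G] [CompactSpace G] [MeasurableSpace G] [BorelSpace G]
  {μ : Measure G} [IsFiniteMeasure μ]

theorem integrable_of_continuous_compact {E : Type*} [NormedAddCommGroup E]
    [SecondCountableTopology E] {f : G → E} (hf : Continuous f) : Integrable f μ := by
  obtain ⟨C, hC⟩ := isCompact_univ.exists_bound_of_continuousOn hf.continuousOn
  borelize E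
  exact Integrable.of_bound hf.measurable.aestronglyMeasurable C
    (Filter.Eventually.of_forall fun x => hC x (Set.mem_univ x))

/-- If a measure preserving map multiplies `u` and `v` by phases whose quotient is `exp I`, then
the cross terms in the `2k`-th moment of `u + v` vanish. -/
theorem integral_norm_add_pow {T : G → G} (hT : ∀ f : G → ℂ, ∫ X, f (T X) ∂μ = ∫ X, f X ∂μ)
    {u v : G → ℂ} (hu : Continuous u) (hv : Continuous v) {α β : ℂ} (hβ : ‖β‖ = 1)
    (hα : α = Complex.exp Complex.I * β)
    (huT : ∀ X, u (T X) = α * u X) (hvT : ∀ X, v (T X) = β * v X) (k : ℕ) :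
    ∫ X, ‖u X + v X‖ ^ (2 * k) ∂μ =
      ∑ i ∈ Finset.range (k + 1), (k.choose i : ℝ) ^ 2 *
        ∫ X, ‖u X‖ ^ (2 * i) * ‖v X‖ ^ (2 * (k - i)) ∂μ := by
  set ω := Complex.exp Complex.I with hω
  have hω0 : ω ≠ 0 := Complex.exp_ne_zero _
  have hωs : ω * star ω = 1 := mul_star_self_of_norm_eq_one norm_exp_I
  have hβs : β * star β = 1 := mul_star_self_of_norm_eq_one hβ
  have hint : ∀ i j : ℕ, Integrable
      (fun X => u X ^ i * v X ^ (k - i) * star (u X ^ j * v X ^ (k - j))) μ := fun i j =>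
    integrable_of_continuous_compact (by fun_prop)
  have hcross : ∀ i ∈ Finset.range (k + 1), ∀ j ∈ Finset.range (k + 1), i ≠ j →
      ∫ X, u X ^ i * v X ^ (k - i) * star (u X ^ j * v X ^ (k - j)) ∂μ = 0 := by
    intro i hi j hj hij
    have hi' : i ≤ k := Nat.lt_succ_iff.mp (Finset.mem_range.mp hi)
    have hj' : j ≤ k := Nat.lt_succ_iff.mp (Finset.mem_range.mp hj)
    have h := hT fun X => u X ^ i * v X ^ (k - i) * star (u X ^ j * v X ^ (k - j))
    have hphase : ∀ X, u (T X) ^ i * v (T X) ^ (k - i) * star (u (T X) ^ j * v (T X) ^ (k - j)) =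
        ω ^ ((i : ℤ) - j) * (u X ^ i * v X ^ (k - i) * star (u X ^ j * v X ^ (k - j))) := by
      intro X
      have hs : star ω = ω⁻¹ := eq_inv_of_mul_eq_one_right hωs
      -- Both factors have total degree `k`, so the common phase `β` cancels and only the quotient
      -- `ω` survives, to the power `i - j`.
      have e1 : β ^ i * β ^ (k - i) * (star β ^ j * star β ^ (k - j)) = 1 := by
        rw [← pow_add, ← pow_add, Nat.add_sub_cancel' hi', Nat.add_sub_cancel' hj', ← mul_pow,
          hβs, one_pow]
      rw [huT, hvT, hα, zpow_sub₀ hω0, zpow_natCast, zpow_natCast, div_eq_mul_inv, ← inv_pow, ← hs]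
      simp only [star_mul', star_pow, mul_pow]
      linear_combination (ω ^ i * star ω ^ j * (u X ^ i * v X ^ (k - i) *
        (star (u X) ^ j * star (v X) ^ (k - j)))) * e1
    simp only [hphase] at h
    rw [integral_const_mul] at h
    have hne := exp_I_zpow_ne_one (n := (i : ℤ) - j) (by omega)
    by_contra hI
    exact hne (mul_right_cancel₀ hI (h.trans (one_mul _).symm))
  have hmain : ((∫ X, ‖u X + v X‖ ^ (2 * k) ∂μ : ℝ) : ℂ) =
      ((∑ i ∈ Finset.range (k + 1), (k.choose i : ℝ) ^ 2 *
        ∫ X, ‖u X‖ ^ (2 * i) * ‖v X‖ ^ (2 * (k - i)) ∂μ : ℝ) : ℂ) := by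
    rw [← integral_complex_ofReal]
    simp only [norm_add_pow_two_mul]
    rw [integral_finsetSum _ fun i _ => integrable_finsetSum _ fun j _ =>
      (hint i j).const_mul _, Complex.ofReal_sum]
    refine Finset.sum_congr rfl fun i hi => ?_
    rw [integral_finsetSum _ fun j _ => (hint i j).const_mul _, Finset.sum_eq_single i]
    · rw [integral_const_mul]
      push_cast
      rw [← integral_complex_ofReal, sq]
      congr 1
      refine integral_congr_ae (Filter.Eventually.of_forall fun X => ?_)
      have h := Complex.mul_conj' (u X ^ i * v X ^ (k - i))
      refine h.trans ?_
      rw [norm_mul, norm_pow, norm_pow]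
      push_cast
      ring
    · intro j hj hji
      rw [integral_const_mul, hcross i hi j hj hji.symm, mul_zero]
    · exact fun h => absurd hi h
  exact_mod_cast hmain

end PhaseAveraging

/-- A `2 × 2` matrix with orthonormal rows is unitary. -/
theorem mem_unitaryGroup_two {a b c d : ℂ} (h1 : a * star a + b * star b = 1)
    (h2 : c * star c + d * star d = 1) (h3 : a * star c + b * star d = 0) :
    !![a, b; c, d] ∈ Matrix.unitaryGroup (Fin 2) ℂ := by
  have h4 : c * star a + d * star b = 0 := by
    have := congrArg star h3
    simpa [mul_comm] using this
  rw [Matrix.mem_unitaryGroup_iff]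
  ext i j
  fin_cases i <;> fin_cases j <;>
    simp [Matrix.mul_apply, Matrix.star_apply] <;> simpa using by assumption

instance (N : ℕ) : (haarU N).IsMulLeftInvariant := by unfold haarU; infer_instance

instance (N : ℕ) : IsProbabilityMeasure (haarU N) :=
  ⟨by simpa [haarU] using Measure.haarMeasure_self (K₀ := (⊤ :
    TopologicalSpace.PositiveCompacts (Matrix.unitaryGroup (Fin N) ℂ)))⟩

theorem continuous_unitaryGroup_entry {N : ℕ} (i j : Fin N) :
    Continuous fun X : Matrix.unitaryGroup (Fin N) ℂ => (X : Matrix (Fin N) (Fin N) ℂ) i j := by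
  exact (continuous_apply_apply i j).comp continuous_subtype_val

/-! ### Moments of entries, trace and derivative on `U(2)` -/

section UnitaryTwo

/-- The group `U(2)`. -/
abbrev UTwo := Matrix.unitaryGroup (Fin 2) ℂ

theorem norm_sq_col_zero (X : UTwo) : ‖X.1 0 0‖ ^ 2 + ‖X.1 1 0‖ ^ 2 = 1 := by
  have h := congrFun (congrFun (Matrix.mem_unitaryGroup_iff'.mp X.2) 0) 0
  simp only [Matrix.mul_apply, Fin.sum_univ_two, Matrix.star_apply, Matrix.one_apply_eq] at h
  have h0 := Complex.conj_mul' (X.1 0 0)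
  have h1 := Complex.conj_mul' (X.1 1 0)
  have : ((‖X.1 0 0‖ ^ 2 + ‖X.1 1 0‖ ^ 2 : ℝ) : ℂ) = 1 := by
    push_cast
    rw [← h0, ← h1]
    exact h
  exact_mod_cast this

theorem norm_sq_row_one (X : UTwo) : ‖X.1 1 0‖ ^ 2 + ‖X.1 1 1‖ ^ 2 = 1 := by
  have h := congrFun (congrFun (Matrix.mem_unitaryGroup_iff.mp X.2) 1) 1
  simp only [Matrix.mul_apply, Fin.sum_univ_two, Matrix.star_apply, Matrix.one_apply_eq] at h
  have h0 := Complex.mul_conj' (X.1 1 0)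
  have h1 := Complex.mul_conj' (X.1 1 1)
  have : ((‖X.1 1 0‖ ^ 2 + ‖X.1 1 1‖ ^ 2 : ℝ) : ℂ) = 1 := by
    push_cast
    rw [← h0, ← h1]
    exact h
  exact_mod_cast this

/-- Column 0 and row 1 are unit vectors sharing the entry `X₁₀`. -/
theorem norm_diag_eq (X : UTwo) : ‖X.1 1 1‖ = ‖X.1 0 0‖ := by
  have h : ‖X.1 1 1‖ ^ 2 = ‖X.1 0 0‖ ^ 2 := by
    linarith [norm_sq_col_zero X, norm_sq_row_one X]
  exact (pow_left_inj₀ (norm_nonneg _) (norm_nonneg _) two_ne_zero).mp h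

theorem norm_det_eq_one (X : UTwo) : ‖X.1.det‖ = 1 := by
  have h := congrArg Matrix.det (Matrix.mem_unitaryGroup_iff.mp X.2)
  rw [Matrix.det_mul, Matrix.star_eq_conjTranspose, Matrix.det_conjTranspose, Matrix.det_one] at h
  have h' := congrArg norm h
  rw [norm_mul, norm_star, norm_one] at h'
  nlinarith [norm_nonneg X.1.det]

theorem integral_mul_left_haarU (g : UTwo) (f : UTwo → ℂ) :
    ∫ X, f (g * X) ∂(haarU 2) = ∫ X, f X ∂(haarU 2) :=
  integral_mul_left_eq_self f g

/-- `diag(e^{i}, 1)`. -/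
noncomputable def phaseDiag : UTwo :=
  ⟨!![Complex.exp Complex.I, 0; 0, 1], mem_unitaryGroup_two
    (by simpa using mul_star_self_of_norm_eq_one norm_exp_I) (by simp) (by simp)⟩

/-- `diag(e^{i}, e^{i})`. -/
noncomputable def phaseScalar : UTwo :=
  ⟨!![Complex.exp Complex.I, 0; 0, Complex.exp Complex.I], mem_unitaryGroup_two
    (by simpa using mul_star_self_of_norm_eq_one norm_exp_I)
    (by simpa using mul_star_self_of_norm_eq_one norm_exp_I) (by simp)⟩

theorem exists_rotation (r : ℝ) : ∃ g : UTwo, ∀ X : UTwo,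
    ‖X.1 0 0 + r * X.1 1 0‖ ^ 2 = (1 + r ^ 2) * ‖(g * X).1 0 0‖ ^ 2 := by
  have hpos : 0 < 1 + r ^ 2 := by positivity
  have hs := Real.sq_sqrt hpos.le
  have hs0 : Real.sqrt (1 + r ^ 2) ≠ 0 := (Real.sqrt_pos.mpr hpos).ne'
  set q := Real.sqrt (1 + r ^ 2) with hq
  have hqC : (q : ℂ) ≠ 0 := by exact_mod_cast hs0
  have hsC : (q : ℂ) ^ 2 = 1 + r ^ 2 := by exact_mod_cast hs
  -- The real rotation whose first row is the unit vector along `(1, r)`.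
  refine ⟨⟨!![((1 / q : ℝ) : ℂ), ((r / q : ℝ) : ℂ); ((-(r / q) : ℝ) : ℂ), ((1 / q : ℝ) : ℂ)],
    mem_unitaryGroup_two ?_ ?_ ?_⟩, fun X => ?_⟩
  · simp only [Complex.star_def, Complex.conj_ofReal]
    push_cast
    field_simp
    rw [hsC]
  · simp only [Complex.star_def, Complex.conj_ofReal]
    push_cast
    field_simp
    rw [hsC]
    ring
  · simp only [Complex.star_def, Complex.conj_ofReal]
    push_cast
    ring
  · have : X.1 0 0 + r * X.1 1 0 = q * (((1 / q : ℝ) : ℂ) * X.1 0 0 + ((r / q : ℝ) : ℂ) * X.1 1 0) := by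
      push_cast
      field_simp
    rw [this, norm_mul, mul_pow, Complex.norm_real, Real.norm_eq_abs, sq_abs, hs]
    simp [Matrix.mul_apply]

open Polynomial in
/-- `|X₀₀|²` and `|X₁₀|²` have the mixed moments of `t` and `1 - t`, with `t` uniform on `[0, 1]`. -/
theorem choose_mul_integral_entry (j i : ℕ) (hi : i ≤ j) :
    (j.choose i : ℝ) * ∫ X : UTwo, ‖X.1 0 0‖ ^ (2 * i) * ‖X.1 1 0‖ ^ (2 * (j - i)) ∂(haarU 2) =
      ∫ X : UTwo, ‖X.1 0 0‖ ^ (2 * j) ∂(haarU 2) := by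
  set M : ℕ → ℝ := fun i =>
    ∫ X : UTwo, ‖X.1 0 0‖ ^ (2 * i) * ‖X.1 1 0‖ ^ (2 * (j - i)) ∂(haarU 2) with hM
  set m := ∫ X : UTwo, ‖X.1 0 0‖ ^ (2 * j) ∂(haarU 2) with hm
  -- `E|X₀₀ + r X₁₀|^(2j)` computed twice: by phase averaging and by rotation invariance.
  have hr : ∀ r : ℝ, ∑ i ∈ Finset.range (j + 1), (j.choose i : ℝ) ^ 2 * (M i * (r ^ 2) ^ (j - i)) =
      (1 + r ^ 2) ^ j * m := by
    intro r
    obtain ⟨g, hg⟩ := exists_rotation r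
    have h1 := integral_norm_add_pow (μ := haarU 2) (T := fun X => phaseDiag * X)
      (integral_mul_left_haarU _) (u := fun X => X.1 0 0) (v := fun X => r * X.1 1 0)
      (continuous_unitaryGroup_entry 0 0) ((continuous_unitaryGroup_entry 1 0).const_mul _)
      (α := Complex.exp Complex.I) (β := 1) norm_one (mul_one _).symm
      (fun X => by simp [phaseDiag, Matrix.mul_apply])
      (fun X => by simp [phaseDiag, Matrix.mul_apply]) j
    have h2 : ∫ X : UTwo, ‖X.1 0 0 + r * X.1 1 0‖ ^ (2 * j) ∂(haarU 2) = (1 + r ^ 2) ^ j * m := by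
      simp_rw [pow_mul, hg, mul_pow, integral_const_mul]
      rw [integral_mul_left_eq_self (fun X : UTwo => (‖X.1 0 0‖ ^ 2) ^ j) g, hm]
      simp_rw [pow_mul]
    rw [← h2, h1]
    refine Finset.sum_congr rfl fun i _ => ?_
    rw [hM, ← integral_mul_const]
    congr 2
    ext X
    rw [norm_mul, mul_pow, Complex.norm_real, Real.norm_eq_abs, pow_mul |r|, sq_abs]
    ring
  have hpoly : ∑ i ∈ Finset.range (j + 1), C ((j.choose i : ℝ) ^ 2 * M i) * X ^ (j - i) =
      (1 + X) ^ j * C m := by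
    -- Every `t ≥ 0` is some `r²`, so the identity holds between polynomials and coefficients can be
    -- compared.
    refine Polynomial.eq_of_infinite_eval_eq _ _ ((Set.Ici_infinite (0 : ℝ)).mono fun t ht => ?_)
    have h := hr (Real.sqrt t)
    rw [Real.sq_sqrt ht] at h
    simpa [eval_finsetSum, mul_assoc] using h
  have hc := congrArg (fun p => p.coeff (j - i)) hpoly
  simp only [finsetSum_coeff, coeff_C_mul_X_pow, coeff_mul_C, coeff_one_add_X_pow] at hc
  rw [Finset.sum_eq_single i, if_pos rfl, Nat.choose_symm hi] at hc
  · have hne : (j.choose i : ℝ) ≠ 0 := by exact_mod_cast (Nat.choose_pos hi).ne'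
    refine mul_left_cancel₀ hne ?_
    rw [← hc]
    ring
  · intro b hb hbi
    rw [if_neg]
    have := Finset.mem_range.mp hb
    omega
  · intro h
    exact absurd (Finset.mem_range.mpr (Nat.lt_succ_of_le hi)) h

/-- The `j + 1` terms in the expansion of `1 = (|X₀₀|² + |X₁₀|²)^j` all have this same integral. -/
theorem integral_norm_entry_pow (j : ℕ) :
    ∫ X : UTwo, ‖X.1 0 0‖ ^ (2 * j) ∂(haarU 2) = 1 / ((j : ℝ) + 1) := by
  have h1 : ∫ X : UTwo, (‖X.1 0 0‖ ^ 2 + ‖X.1 1 0‖ ^ 2) ^ j ∂(haarU 2) = 1 := by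
    simp [norm_sq_col_zero]
  simp_rw [add_pow] at h1
  rw [integral_finsetSum] at h1
  · have h2 : ∀ i ∈ Finset.range (j + 1),
        ∫ X : UTwo, (‖X.1 0 0‖ ^ 2) ^ i * (‖X.1 1 0‖ ^ 2) ^ (j - i) * (j.choose i : ℝ) ∂(haarU 2) =
          ∫ X : UTwo, ‖X.1 0 0‖ ^ (2 * j) ∂(haarU 2) := by
      intro i hi
      rw [← choose_mul_integral_entry j i (Nat.lt_succ_iff.mp (Finset.mem_range.mp hi)),
        integral_mul_const, mul_comm]
      simp_rw [pow_mul]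
    rw [Finset.sum_congr rfl h2, Finset.sum_const, Finset.card_range, nsmul_eq_mul] at h1
    rw [eq_div_iff (by positivity)]
    push_cast at h1
    linarith
  · intro i _
    exact integrable_of_continuous_compact
      (((((continuous_unitaryGroup_entry 0 0).norm.pow 2).pow i).mul
        (((continuous_unitaryGroup_entry 1 0).norm.pow 2).pow (j - i))).mul continuous_const)

theorem integral_norm_trace_pow (j : ℕ) :
    ∫ X : UTwo, ‖X.1 0 0 + X.1 1 1‖ ^ (2 * j) ∂(haarU 2) =
      ((2 * j).choose j : ℝ) / ((j : ℝ) + 1) := by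
  rw [integral_norm_add_pow (μ := haarU 2) (T := fun X => phaseDiag * X)
      (integral_mul_left_haarU _) (u := fun X => X.1 0 0) (v := fun X => X.1 1 1)
      (continuous_unitaryGroup_entry 0 0) (continuous_unitaryGroup_entry 1 1)
      (α := Complex.exp Complex.I) (β := 1) norm_one (mul_one _).symm
      (fun X => by simp [phaseDiag, Matrix.mul_apply])
      (fun X => by simp [phaseDiag, Matrix.mul_apply]) j]
  have h : ∀ i ∈ Finset.range (j + 1), (j.choose i : ℝ) ^ 2 *
      ∫ X : UTwo, ‖X.1 0 0‖ ^ (2 * i) * ‖X.1 1 1‖ ^ (2 * (j - i)) ∂(haarU 2) =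
        (j.choose i : ℝ) ^ 2 * (1 / ((j : ℝ) + 1)) := by
    intro i hi
    rw [← integral_norm_entry_pow j]
    simp_rw [norm_diag_eq, ← pow_add]
    have := Finset.mem_range.mp hi
    rw [show 2 * i + 2 * (j - i) = 2 * j by omega]
  rw [Finset.sum_congr rfl h, ← Finset.sum_mul, mul_one_div]
  congr 1
  exact_mod_cast Nat.sum_range_choose_sq j

theorem charPolyU_two (X : UTwo) (s : ℂ) :
    charPolyU X s = 1 - s * star (X.1 0 0 + X.1 1 1) + s ^ 2 * star X.1.det := by
  rw [charPolyU, Matrix.det_fin_two, Matrix.det_fin_two]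
  simp [Matrix.conjTranspose_apply]
  ring

theorem norm_deriv_charPolyU_two (X : UTwo) (x : ℂ) :
    ‖deriv (charPolyU X) x‖ = ‖-2 * star x * X.1.det + (X.1 0 0 + X.1 1 1)‖ := by
  have h : HasDerivAt (charPolyU X)
      (-(1 * star (X.1 0 0 + X.1 1 1)) + 2 * x * star X.1.det) x := by
    rw [show charPolyU X = _ from funext (charPolyU_two X)]
    refine (((hasDerivAt_id x).mul_const _).const_sub 1).add ?_
    simpa using (hasDerivAt_pow 2 x).mul_const (star X.1.det)
  rw [h.deriv, ← norm_neg, ← norm_star]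
  congr 1
  simp

theorem integral_norm_deriv_charPolyU_pow (k : ℕ) (x : ℂ) :
    ∫ X : UTwo, ‖deriv (charPolyU X) x‖ ^ (2 * k) ∂(haarU 2) =
      ∑ m ∈ Finset.range (k + 1),
        ((k.choose m : ℝ) ^ 2 * (4 * ‖x‖ ^ 2) ^ m * ((2 * k - 2 * m).choose (k - m) : ℝ)) /
          ((k : ℝ) - (m : ℝ) + 1) := by
  simp_rw [norm_deriv_charPolyU_two]
  rw [integral_norm_add_pow (μ := haarU 2) (T := fun X => phaseScalar * X)
      (integral_mul_left_haarU _) (u := fun X => -2 * star x * X.1.det)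
      (v := fun X => X.1 0 0 + X.1 1 1)
      (continuous_const.mul (continuous_subtype_val.matrix_det))
      ((continuous_unitaryGroup_entry 0 0).add (continuous_unitaryGroup_entry 1 1))
      (α := Complex.exp Complex.I * Complex.exp Complex.I) (β := Complex.exp Complex.I)
      norm_exp_I rfl
      (fun X => by
        have : (phaseScalar * X).1.det = Complex.exp Complex.I * Complex.exp Complex.I * X.1.det := by
          rw [show (phaseScalar * X).1 = phaseScalar.1 * X.1 from rfl, Matrix.det_mul]
          simp [phaseScalar, Matrix.det_fin_two]
        rw [this]
        ring)
      (fun X => by simp [phaseScalar, Matrix.mul_apply]; ring) k]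
  refine Finset.sum_congr rfl fun m hm => ?_
  have hmk : m ≤ k := Nat.lt_succ_iff.mp (Finset.mem_range.mp hm)
  have hn : ∀ X : UTwo, ‖-2 * star x * X.1.det‖ ^ (2 * m) = (4 * ‖x‖ ^ 2) ^ m := by
    intro X
    rw [norm_mul, norm_det_eq_one, norm_mul, norm_star, norm_neg, pow_mul]
    norm_num [mul_pow]
  simp_rw [hn]
  rw [integral_const_mul, integral_norm_trace_pow, ← Nat.mul_sub, Nat.cast_sub hmk]
  ring

end UnitaryTwo

/-! ### The finite sum as a `₃F₂` -/

section Hypergeometric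

theorem risingFactorial_succ (a : ℂ) (n : ℕ) :
    risingFactorial a (n + 1) = risingFactorial a n * (a + n) :=
  Finset.prod_range_succ _ _

theorem risingFactorial_neg_natCast_eq_zero {k n : ℕ} (h : k < n) :
    risingFactorial (-(k : ℂ)) n = 0 :=
  Finset.prod_eq_zero (Finset.mem_range.mpr h) (by simp)

/-- By parity; this keeps the denominators `(1/2 - k)_n` nonzero. -/
theorem half_sub_natCast_add_ne_zero (k n : ℕ) : (1 / 2 - (k : ℂ) + n) ≠ 0 := by
  intro h
  have h' : (1 + 2 * n : ℂ) = 2 * k := by linear_combination 2 * h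
  have : 1 + 2 * n = 2 * k := by exact_mod_cast h'
  omega

theorem risingFactorial_one (n : ℕ) : risingFactorial 1 n = n.factorial := by
  induction n with
  | zero => simp [risingFactorial]
  | succ n ih =>
    rw [risingFactorial_succ, ih, Nat.factorial_succ]
    push_cast
    ring

theorem risingFactorial_half_sub_ne_zero (k n : ℕ) : risingFactorial (1 / 2 - (k : ℂ)) n ≠ 0 :=
  Finset.prod_ne_zero_iff.mpr fun i _ => half_sub_natCast_add_ne_zero k i

/-- Induction on `n` with `k` fixed: writing `k = n + 1 + p`, each step multiplies both sides by
`-(p + 2) (p + 1)²`. On the right this uses the recurrences for `choose` and `centralBinom`. -/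
theorem hypergeometric_coeff (k n : ℕ) (hn : n ≤ k) :
    ((2 * k).choose k : ℂ) / ((k : ℂ) + 1) *
      (risingFactorial (-1 - (k : ℂ)) n * risingFactorial (-(k : ℂ)) n *
        risingFactorial (-(k : ℂ)) n) =
      ((k.choose n : ℂ) ^ 2 * 4 ^ n * ((k - n).centralBinom : ℂ) / ((k : ℂ) - n + 1)) *
        (risingFactorial 1 n * risingFactorial (1 / 2 - (k : ℂ)) n * (n.factorial : ℂ)) := by
  induction n with
  | zero => simp [risingFactorial, Nat.centralBinom]
  | succ n ih =>
    have ih := ih (by omega)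
    obtain ⟨p, rfl⟩ : ∃ p, k = n + 1 + p := ⟨k - (n + 1), by omega⟩
    have e1 : n + 1 + p - n = p + 1 := by omega
    have e2 : n + 1 + p - (n + 1) = p := by omega
    have hch : ((n + 1 + p).choose (n + 1) : ℂ) * (n + 1) = ((n + 1 + p).choose n : ℂ) * (p + 1) := by
      have := Nat.choose_succ_right_eq (n + 1 + p) n
      rw [e1] at this
      exact_mod_cast this
    have hcb : ((p : ℂ) + 1) * ((p + 1).centralBinom : ℂ) = 2 * (2 * p + 1) * (p.centralBinom : ℂ) := by
      exact_mod_cast Nat.succ_mul_centralBinom_succ p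
    rw [e1] at ih
    rw [e2]
    simp only [risingFactorial_succ, Nat.factorial_succ]
    push_cast at ih ⊢
    have hp1 : (p : ℂ) + 1 ≠ 0 := by exact_mod_cast Nat.succ_ne_zero p
    have hp2 : (p : ℂ) + 2 ≠ 0 := by exact_mod_cast Nat.succ_ne_zero (p + 1)
    have d1 : ((n : ℂ) + 1 + p - n + 1) = p + 2 := by ring
    have d2 : ((n : ℂ) + 1 + p - (n + 1) + 1) = p + 1 := by ring
    rw [d1] at ih
    rw [d2]
    set A := risingFactorial (-1 - ((n : ℂ) + 1 + p)) n
    set B := risingFactorial (-((n : ℂ) + 1 + p)) n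
    set D := risingFactorial (1 / 2 - ((n : ℂ) + 1 + p)) n
    set F := risingFactorial 1 n
    set c := ((n + 1 + p).choose n : ℂ)
    set c' := ((n + 1 + p).choose (n + 1) : ℂ)
    set b := (p.centralBinom : ℂ)
    set b' := ((p + 1).centralBinom : ℂ)
    have hb' : b' = 2 * (2 * p + 1) * b / (p + 1) := by
      rw [eq_div_iff hp1, ← hcb]; ring
    calc _ = (((2 * (n + 1 + p)).choose (n + 1 + p) : ℂ) / ((n : ℂ) + 1 + p + 1) * (A * B * B)) *
          (-(p + 2) * (p + 1) ^ 2) := by ring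
      _ = c ^ 2 * 4 ^ n * b' / (p + 2) * (F * D * n.factorial) * (-(p + 2) * (p + 1) ^ 2) := by
          rw [ih]
      _ = (c * (p + 1)) ^ 2 * 4 ^ n * 2 * (-(2 * p + 1)) * b / (p + 1) * (F * D * n.factorial) := by
          rw [hb']
          field_simp
      _ = _ := by
          rw [← hch]
          field_simp
          ring

theorem sum_eq_hypergeometric (k : ℕ) (z : ℂ) :
    ∑ m ∈ Finset.range (k + 1),
        ((k.choose m : ℂ) ^ 2 * (4 * z) ^ m * ((2 * k - 2 * m).choose (k - m) : ℂ)) /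
          ((k : ℂ) - (m : ℂ) + 1) =
      ((2 * k).choose k : ℂ) / ((k : ℂ) + 1) *
        hypergeometric₃F₂ (-1 - (k : ℂ)) (-(k : ℂ)) (-(k : ℂ)) 1 (1 / 2 - (k : ℂ)) z := by
  -- The series stops at `n = k` because `(-k)_n = 0` beyond it.
  rw [hypergeometric₃F₂, tsum_eq_sum (s := Finset.range (k + 1)), Finset.mul_sum]
  · refine Finset.sum_congr rfl fun n hn => ?_
    have h := hypergeometric_coeff k n (Nat.lt_succ_iff.mp (Finset.mem_range.mp hn))
    have h1 : risingFactorial 1 n ≠ 0 := by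
      rw [risingFactorial_one]
      exact_mod_cast n.factorial_ne_zero
    have h2 := risingFactorial_half_sub_ne_zero k n
    have h3 : (n.factorial : ℂ) ≠ 0 := by exact_mod_cast n.factorial_ne_zero
    rw [Nat.centralBinom, Nat.mul_sub, ← div_eq_iff (mul_ne_zero (mul_ne_zero h1 h2) h3)] at h
    rw [mul_pow]
    calc _ = (k.choose n : ℂ) ^ 2 * 4 ^ n * ((2 * k - 2 * n).choose (k - n) : ℂ) /
          ((k : ℂ) - n + 1) * z ^ n := by ring
      _ = _ := by
        rw [← h]
        field_simp
  · intro n hn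
    rw [risingFactorial_neg_natCast_eq_zero (by simpa using hn)]
    simp

end Hypergeometric

theorem theorem4p1 (k : ℕ) (hk : 0 < k) (x : ℂ) :
    (∫ X : Matrix.unitaryGroup (Fin 2) ℂ, ‖deriv (charPolyU X) x‖ ^ (2 * k) ∂(haarU 2) =
      ∑ m ∈ Finset.range (k + 1),
        ((k.choose m : ℝ) ^ 2 * (4 * ‖x‖ ^ 2) ^ m * ((2 * k - 2 * m).choose (k - m) : ℝ)) /
          ((k : ℝ) - (m : ℝ) + 1)) ∧
    ((∑ m ∈ Finset.range (k + 1),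
        ((k.choose m : ℝ) ^ 2 * (4 * ‖x‖ ^ 2) ^ m * ((2 * k - 2 * m).choose (k - m) : ℝ)) /
          ((k : ℝ) - (m : ℝ) + 1) : ℝ) : ℂ) =
      ((2 * k).choose k : ℂ) / ((k : ℂ) + 1) *
        hypergeometric₃F₂ (-1 - (k : ℂ)) (-(k : ℂ)) (-(k : ℂ)) 1 (1 / 2 - (k : ℂ))
          ((‖x‖ : ℂ) ^ 2) := by
  refine ⟨integral_norm_deriv_charPolyU_pow k x, ?_⟩
  rw [← sum_eq_hypergeometric]
  push_cast
  rfl
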